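/- **Codes with hierarchical locality.** For a linear code $\mathcal C\subseteq K^I$ and $S\subseteq I$, the punctured code $\mathcal C|_S$ consists of the restrictions to $S$ of the codewords of $\mathcal C$. An $[n,k,d]$ code is a linear code of length $n$, dimension $k$ and minimum distance $d$. $\mathcal C$ has $(r,\delta)$-locality if every coordinate $i$ lies in some $S$ with $\dim \mathcal C|_S\le r$ and $d_{\min}(\mathcal C|_S)\ge\delta$. $\mathcal C$ has hierarchical locality with parameters $[(r_1,\delta_1),(r_2,\delta_2)]$ if every coordinate $i$ lies in some $S$ such that $\dim \mathcal C|_S\le r_1$, $d_{\min}(\mathcal C|_S)\ge\delta_1$ and $\mathcal C|_S$ has $(r_2,\delta_2)$-locality. **Construction.** Let $n_2\mid n_1\mid n$ be positive integers, $\mu_2=n_1/n_2$, $\bar\mu_1=n/n_1$, and let $1\le r_2\le n_2$, $1\le r_1\le\mu_2r_2$, $1\le k\le\bar\mu_1r_1$. Let $\mathbb F=\mathbb F_{p^m}$ be a finite field with $n_1\mid p^m-1$ and $n<p^m$, let $\beta_0$ be a primitive element of $\mathbb F$, let $\beta_1,\beta_2\in\mathbb F^*$ have orders $n_1,n_2$,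 and let $H_i=\langle\beta_i\rangle$ for $i=1,2$. For $0\le t<\bar\mu_1$ and $0\le s<\mu_2$ put $$A_t=\beta_0^tH_1,\qquad A_{t,s}=\beta_0^t\beta_1^sH_2\subseteq A_t,\qquad A=\bigcup_{0\le t<\bar\mu_1}A_t,$$ $$E_t(X)=\prod_{\substack{0\le a<\bar\mu_1\\ a\ne t}}\frac{X^{n_1}-\beta_0^{an_1}}{\beta_0^{tn_1}-\beta_0^{an_1}},\qquad E_{t,s}(X)=\prod_{\substack{0\le b<\mu_2\\ b\ne s}}\frac{X^{n_2}-(\beta_0^{t}\beta_1^{b})^{n_2}}{(\beta_0^{t}\beta_1^{s})^{n_2}-(\beta_0^{t}\beta_1^{b})^{n_2}} .$$ Let $\mathrm{Trunc}(S,r)$ denote the set of the $r$ smallest elements of a finite set $S$ of non-negative integers, and put $$e_2=\mathrm{Trunc}(\{0,\dots,n_2-1\},r_2),\quad S_1=\bigcup_{j=0}^{\mu_2-1}(jn_2+e_2),\quad e_1=\mathrm{Trunc}(S_1,r_1),\quad S_0=\bigcup_{j=0}^{\bar\mu_1-1}(jn_1+e_1),\quad e_0=\mathrm{Trunc}(S_0,k).$$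 Consider all families of message polynomials $u_{t,s}\in\mathbb F[X]$ ($0\le t<\bar\mu_1$, $0\le s<\mu_2$) of degree less than $r_2$, and put $c_t=\sum_su_{t,s}E_{t,s}$ and $c=\sum_tc_tE_t$, that are precoded in the following sense: for every $t$, the coefficients of $c_t$ at the exponents in $S_1\setminus e_1$ vanish, and the coefficients of $c$ at the exponents in $S_0\setminus e_0$ vanish. The code $\mathcal C$ is the set of all codewords $(c(\theta))_{\theta\in A}$ obtained from such families. **Theorem.** Suppose that $r_2\mid r_1\mid k$. Then there are $\delta_1$, $\delta_2$ and $d$ such that $\mathcal C$ is an $[n,k,d]$ linear code, each middle code $\mathcal C|_{A_t}$ is an $[n_1,r_1,\delta_1]$ code, each local code $\mathcal C|_{A_{t,s}}$ is an $[n_2,r_2,\delta_2]$ code, $\mathcal C$ has hierarchical locality with parameters $[(r_1,\delta_1),(r_2,\delta_2)]$, and $$d=n-k+1-\left(\left\lceil\frac{k}{r_2}\right\rceil-1\right)(\delta_2-1)-\left(\left\lceil\frac{k}{r_1}\right\rceil-1\right)(\delta_1-\delta_2).$$ Moreover $d$ is optimal: every $[n,k,d']$ linear code, over any field, that has hierarchical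 locality with parameters $[(r_1,\delta_1),(r_2,\delta_2)]$ satisfies $d'\le d$. -/

import Mathlib

open Polynomial

/-! ### Linear codes, punctured codes, locality -/

section Codes

variable {K : Type*} [Field K] {ι : Type*} [Fintype ι]

/-- The Hamming weights of the nonzero codewords of a linear code. -/
def codeWeights (C : Submodule K (ι → K)) : Set ℕ :=
  open Classical in {w | ∃ c ∈ C, c ≠ 0 ∧ hammingNorm c = w}

/-- `C` is an `[n, k, d]` linear code: it has length `n`, dimension `k`, and its minimum distance,
the least weight of a nonzero codeword, is `d`. -/
def IsLinearCode (C : Submodule K (ι → K)) (n k d : ℕ) : Prop :=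
  Fintype.card ι = n ∧ Module.finrank K C = k ∧ IsLeast (codeWeights C) d

/-- The punctured code `C|_S`: the codewords of `C` restricted to the coordinates in `S`. -/
def punctured (C : Submodule K (ι → K)) (S : Finset ι) : Submodule K (S → K) :=
  C.map (LinearMap.funLeft K K (Subtype.val : S → ι))

/-- `d_min(C) ≥ δ` (the minimum distance of the zero code being infinite). -/
def MinDistGE (C : Submodule K (ι → K)) (δ : ℕ) : Prop :=
  ∀ w ∈ codeWeights C, δ ≤ w

/-- `C` has (all-symbol) `(r, δ)`-locality. -/
def HasLocality (C : Submodule K (ι → K)) (r δ : ℕ) : Prop :=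
  ∀ i : ι, ∃ S : Finset ι, i ∈ S ∧
    Module.finrank K (punctured C S) ≤ r ∧ MinDistGE (punctured C S) δ

/-- `C` has (two-level, all-symbol) hierarchical locality with locality parameters
`[(r₁, δ₁), (r₂, δ₂)]`. -/
def HasHierarchicalLocality (C : Submodule K (ι → K)) (r₁ δ₁ r₂ δ₂ : ℕ) : Prop :=
  ∀ i : ι, ∃ S : Finset ι, i ∈ S ∧
    Module.finrank K (punctured C S) ≤ r₁ ∧ MinDistGE (punctured C S) δ₁ ∧
    HasLocality (punctured C S) r₂ δ₂

end Codes

/-! ### Exponent sets -/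

/-- The `r` smallest elements of a finite set of natural numbers. -/
def trunc (S : Finset ℕ) (r : ℕ) : Finset ℕ :=
  S.filter fun x => (S.filter fun y => y < x).card < r

/-- The union of the translates `j * s + S` for `j < μ`. -/
def translates (S : Finset ℕ) (s μ : ℕ) : Finset ℕ :=
  (Finset.range μ).biUnion fun j => S.image fun e => j * s + e

/-- Numerical parameters of the construction: the lengths `n`, `n₁`, `n₂` of the global, middle and
local codes and their dimensions `k`, `r₁`, `r₂`. -/
structure CodeParams where
  n : ℕ
  n₁ : ℕ
  n₂ : ℕ
  k : ℕ
  r₁ : ℕ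
  r₂ : ℕ

namespace CodeParams

variable (P : CodeParams)

/-- The number of middle codes. -/
def numMiddle : ℕ := P.n / P.n₁

/-- The number of local codes in each middle code. -/
def numLocal : ℕ := P.n₁ / P.n₂

/-- Exponents of a second level code polynomial. -/
def exp₂ : Finset ℕ := trunc (Finset.range P.n₂) P.r₂

/-- Exponents of a first level polynomial before precoding. -/
def preExp₁ : Finset ℕ := translates P.exp₂ P.n₂ P.numLocal

/-- Exponents of a first level code polynomial. -/
def exp₁ : Finset ℕ := trunc P.preExp₁ P.r₁

/-- Exponents of the zeroth level polynomial before precoding. -/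
def preExp₀ : Finset ℕ := translates P.exp₁ P.n₁ P.numMiddle

/-- Exponents of the code polynomial. -/
def exp₀ : Finset ℕ := trunc P.preExp₀ P.k

end CodeParams

/-! ### The construction

`β₀` is a primitive element of the field `F`, and `β₁`, `β₂` have orders `n₁`, `n₂`.  Vertices of the
coset tree are indexed from zero: the middle code number `t` (with `t < n / n₁`) lives on the coset
`β₀ ^ t * H₁`, and the local code number `s` (with `s < n₁ / n₂`) inside it lives on the coset
`β₀ ^ t * β₁ ^ s * H₂`. -/

namespace HierCode

variable {F : Type*} [Field F]

/-- The coset `γ * {1, β, …, β ^ (m - 1)}`. -/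
def coset [DecidableEq F] (γ β : F) (m : ℕ) : Finset F :=
  (Finset.range m).image fun e => γ * β ^ e

/-- The coset carrying the middle code number `t`. -/
def middleSet [DecidableEq F] (P : CodeParams) (β₀ β₁ : F) (t : ℕ) : Finset F :=
  coset (β₀ ^ t) β₁ P.n₁

/-- The coset carrying the local code number `s` of the middle code number `t`. -/
def localSet [DecidableEq F] (P : CodeParams) (β₀ β₁ β₂ : F) (t s : ℕ) : Finset F :=
  coset (β₀ ^ t * β₁ ^ s) β₂ P.n₂

/-- The set of evaluation points. -/
def evalSet [DecidableEq F] (P : CodeParams) (β₀ β₁ : F) : Finset F :=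
  (Finset.range P.numMiddle).biUnion fun t => middleSet P β₀ β₁ t

/-- The polynomial `∏ (X ^ m - γ_s ^ m) / (γ_t ^ m - γ_s ^ m)`, the product being taken over the
siblings `s < μ`, `s ≠ t`, of the vertex `t`. -/
noncomputable def idem (γ : ℕ → F) (m μ t : ℕ) : F[X] :=
  ∏ s ∈ (Finset.range μ).erase t, (C ((γ t ^ m - γ s ^ m)⁻¹) * (X ^ m - C (γ s ^ m)))

/-- The polynomial `E` of the first level vertex `t`. -/
noncomputable def E₁ (P : CodeParams) (β₀ : F) (t : ℕ) : F[X] :=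
  idem (fun a => β₀ ^ a) P.n₁ P.numMiddle t

/-- The polynomial `E` of the second level vertex `(t, s)`. -/
noncomputable def E₂ (P : CodeParams) (β₀ β₁ : F) (t s : ℕ) : F[X] :=
  idem (fun b => β₀ ^ t * β₁ ^ b) P.n₂ P.numLocal s

/-- The first level polynomial of the vertex `t` built from the message polynomials `u`. -/
noncomputable def poly₁ (P : CodeParams) (β₀ β₁ : F) (u : ℕ → ℕ → F[X]) (t : ℕ) : F[X] :=
  ∑ s ∈ Finset.range P.numLocal, u t s * E₂ P β₀ β₁ t s

/-- The zeroth level polynomial built from the message polynomials `u`. -/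
noncomputable def poly₀ (P : CodeParams) (β₀ β₁ : F) (u : ℕ → ℕ → F[X]) : F[X] :=
  ∑ t ∈ Finset.range P.numMiddle, poly₁ P β₀ β₁ u t * E₁ P β₀ t

/-- The families of precoded message polynomials: each polynomial has degree less than `r₂`, the
precoding at the first level makes all but the `r₁` lowest monomials of every first level polynomial
vanish, and the precoding at the zeroth level makes all but the `k` lowest monomials of the zeroth
level polynomial vanish. -/
structure IsPrecoded (P : CodeParams) (β₀ β₁ : F) (u : ℕ → ℕ → F[X]) : Prop where
  degree_lt : ∀ t < P.numMiddle, ∀ s < P.numLocal, (u t s).degree < P.r₂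
  level₁ : ∀ t < P.numMiddle, ∀ e ∈ P.preExp₁ \ P.exp₁, (poly₁ P β₀ β₁ u t).coeff e = 0
  level₀ : ∀ e ∈ P.preExp₀ \ P.exp₀, (poly₀ P β₀ β₁ u).coeff e = 0

theorem poly₁_add (P : CodeParams) (β₀ β₁ : F) (u v : ℕ → ℕ → F[X]) (t : ℕ) :
    poly₁ P β₀ β₁ (u + v) t = poly₁ P β₀ β₁ u t + poly₁ P β₀ β₁ v t := by
  simp [poly₁, add_mul, Finset.sum_add_distrib]

theorem poly₁_smul (P : CodeParams) (β₀ β₁ : F) (a : F) (u : ℕ → ℕ → F[X]) (t : ℕ) :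
    poly₁ P β₀ β₁ (a • u) t = a • poly₁ P β₀ β₁ u t := by
  simp [poly₁, Finset.smul_sum]

theorem poly₁_zero (P : CodeParams) (β₀ β₁ : F) (t : ℕ) : poly₁ P β₀ β₁ 0 t = 0 := by
  simp [poly₁]

theorem poly₀_add (P : CodeParams) (β₀ β₁ : F) (u v : ℕ → ℕ → F[X]) :
    poly₀ P β₀ β₁ (u + v) = poly₀ P β₀ β₁ u + poly₀ P β₀ β₁ v := by
  simp [poly₀, poly₁_add, add_mul, Finset.sum_add_distrib]

theorem poly₀_smul (P : CodeParams) (β₀ β₁ : F) (a : F) (u : ℕ → ℕ → F[X]) :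
    poly₀ P β₀ β₁ (a • u) = a • poly₀ P β₀ β₁ u := by
  simp [poly₀, poly₁_smul, Finset.smul_sum]

theorem poly₀_zero (P : CodeParams) (β₀ β₁ : F) : poly₀ P β₀ β₁ 0 = 0 := by
  simp [poly₀, poly₁_zero]

/-- The constructed code: the evaluations of the code polynomials `c(X)` at the points of
`evalSet`. -/
noncomputable def code [DecidableEq F] (P : CodeParams) (β₀ β₁ : F) :
    Submodule F (evalSet P β₀ β₁ → F) where
  carrier := {c | ∃ u : ℕ → ℕ → F[X], IsPrecoded P β₀ β₁ u ∧
    ∀ θ : evalSet P β₀ β₁, c θ = (poly₀ P β₀ β₁ u).eval (θ : F)}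
  zero_mem' := by
    refine ⟨0, ⟨?_, ?_, ?_⟩, ?_⟩
    · intro t _ s _
      simp
    · intro t _ e _
      simp [poly₁_zero]
    · intro e _
      simp [poly₀_zero]
    · intro θ
      simp [poly₀_zero]
  add_mem' := by
    rintro c c' ⟨u, hu, hc⟩ ⟨v, hv, hc'⟩
    refine ⟨u + v, ⟨?_, ?_, ?_⟩, ?_⟩
    · intro t ht s hs
      exact (degree_add_le _ _).trans_lt (max_lt (hu.degree_lt t ht s hs) (hv.degree_lt t ht s hs))
    · intro t ht e he
      rw [poly₁_add, coeff_add, hu.level₁ t ht e he, hv.level₁ t ht e he, add_zero]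
    · intro e he
      rw [poly₀_add, coeff_add, hu.level₀ e he, hv.level₀ e he, add_zero]
    · intro θ
      rw [poly₀_add, eval_add, Pi.add_apply, hc, hc']
  smul_mem' := by
    rintro a c ⟨u, hu, hc⟩
    refine ⟨a • u, ⟨?_, ?_, ?_⟩, ?_⟩
    · intro t ht s hs
      exact (degree_smul_le _ _).trans_lt (hu.degree_lt t ht s hs)
    · intro t ht e he
      rw [poly₁_smul, coeff_smul, hu.level₁ t ht e he, smul_zero]
    · intro e he
      rw [poly₀_smul, coeff_smul, hu.level₀ e he, smul_zero]
    · intro θ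
      rw [poly₀_smul, eval_smul, Pi.smul_apply, hc]

/-- The coordinates of the code that belong to a set `S` of points of the field. -/
def coords [DecidableEq F] (P : CodeParams) (β₀ β₁ : F) (S : Finset F) : Finset (evalSet P β₀ β₁) :=
  S.subtype (· ∈ evalSet P β₀ β₁)

end HierCode

/-!
Two ingredients meet in the theorem: an upper bound on the minimum distance of a code with
hierarchical locality, and an explicit description of the constructed code, which attains it.

*The bound.*  In the matroid of a code `C` of dimension `k`, whenever a set `T` of coordinates has
rank less than `k` some nonzero codeword vanishes on `T`, so `T` should be taken large at rank
`k - 1`, that is, of large nullity `|T| - rank T`.  Adjoining to `T` a set `S` with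
`d_min(C|_S) ≥ δ` that is not spanned by `T` raises the nullity by at least `δ - 1`
(`IsRepairSet.codeRank_union_add_le`).  Starting from the empty set, local sets are adjoined inside
one middle set until the next one would complete it; the whole middle set is adjoined in its place.
Every step costs at most `r₂` in rank and gains `δ₂ - 1` in nullity, and every completed middle set
gains a further `δ₁ - δ₂`.  Since `k` exceeds `A₂ r₂` and `A₁ r₁`, at least `A₂` steps and `A₁`
completions take place before the rank reaches `k` (`exists_codeRank_lt_of_greedy`,
`HasNestedRepair.exists_mem_codeWeights`).

*The construction.*  As the polynomials `E` are Lagrange basis polynomials in `X ^ n₁` and in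
`X ^ n₂`, the code polynomials are exactly the polynomials with exponents in `exp₀`
(`HierCode.code_eq_monomialCode`).  Because `r₂ ∣ r₁ ∣ k`, the sets `exp₁` and `exp₀` are unions of
whole translates of `exp₂` and `exp₁` (`trunc_translates`).  On a middle set `X ^ n₁` is constant,
so the middle code is the evaluation code with exponents `exp₁`; on a local set `X ^ n₂` is constant
and the local code is a Reed-Solomon code (`monomialCode_translates`).  Dimensions are the numbers
of exponents, and counting roots bounds each of the three minimum distances from below; the bound
above, applied to the local, the middle and the global code, shows that all three estimates are
equalities (`HasNestedRepair.isLinearCode`).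
-/

/-! ### The rank function of a linear code -/

section Rank

variable {K : Type*} [Field K] {ι : Type*}

/-- The subcode of the codewords of `C` that vanish on `T`. -/
def vanishingOn (C : Submodule K (ι → K)) (T : Finset ι) : Submodule K (ι → K) where
  carrier := {c | c ∈ C ∧ ∀ i ∈ T, c i = 0}
  zero_mem' := ⟨C.zero_mem, fun _ _ => rfl⟩
  add_mem' := fun ha hb =>
    ⟨C.add_mem ha.1 hb.1, fun i hi => by simp [ha.2 i hi, hb.2 i hi]⟩
  smul_mem' := fun a _ hb => ⟨C.smul_mem a hb.1, fun i hi => by simp [hb.2 i hi]⟩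

theorem mem_vanishingOn {C : Submodule K (ι → K)} {T : Finset ι} {c : ι → K} :
    c ∈ vanishingOn C T ↔ c ∈ C ∧ ∀ i ∈ T, c i = 0 := Iff.rfl

variable [Fintype ι]

/-- The rank of a set of coordinates in the matroid of `C`. -/
noncomputable def codeRank (C : Submodule K (ι → K)) (T : Finset ι) : ℕ :=
  Module.finrank K (punctured C T)

/-- Rank-nullity for the restriction of the codewords along a map of coordinates. -/
theorem finrank_map_funLeft_add {κ : Type*} [Fintype κ] (C : Submodule K (ι → K)) (f : κ → ι)
    {T : Finset ι} (hT : ∀ i, i ∈ T ↔ ∃ j, f j = i) :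
    Module.finrank K (C.map (LinearMap.funLeft K K f)) + Module.finrank K (vanishingOn C T) =
      Module.finrank K C := by
  have h := LinearMap.finrank_range_add_finrank_ker ((LinearMap.funLeft K K f).domRestrict C)
  rw [LinearMap.range_domRestrict] at h
  have hker : vanishingOn C T = Submodule.map C.subtype
      (LinearMap.ker ((LinearMap.funLeft K K f).domRestrict C)) := by
    ext c
    simp only [mem_vanishingOn, Submodule.mem_map, LinearMap.mem_ker, Subtype.exists, hT]
    constructor
    · rintro ⟨hc, h0⟩
      refine ⟨c, hc, ?_, rfl⟩
      ext j
      exact h0 _ ⟨j, rfl⟩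
    · rintro ⟨c', hc, h0, rfl⟩
      refine ⟨hc, ?_⟩
      rintro _ ⟨j, rfl⟩
      exact congrFun h0 j
  rw [hker, Submodule.finrank_map_subtype_eq, h]

theorem codeRank_add_finrank_vanishingOn (C : Submodule K (ι → K)) (T : Finset ι) :
    codeRank C T + Module.finrank K (vanishingOn C T) = Module.finrank K C :=
  finrank_map_funLeft_add C _ fun i => by simp

theorem codeRank_le_card (C : Submodule K (ι → K)) (T : Finset ι) : codeRank C T ≤ T.card := by
  have h := Submodule.finrank_le (punctured C T)
  simpa [codeRank] using h

theorem codeRank_le_of_vanishingOn_le {C : Submodule K (ι → K)} {S T : Finset ι}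
    (h : vanishingOn C T ≤ vanishingOn C S) : codeRank C S ≤ codeRank C T := by
  have h1 := codeRank_add_finrank_vanishingOn C S
  have h2 := codeRank_add_finrank_vanishingOn C T
  have h3 := Submodule.finrank_mono h
  omega

theorem codeRank_mono (C : Submodule K (ι → K)) {S T : Finset ι} (h : S ⊆ T) :
    codeRank C S ≤ codeRank C T :=
  codeRank_le_of_vanishingOn_le fun _ hc => ⟨hc.1, fun i hi => hc.2 i (h hi)⟩

theorem exists_ne_zero_of_codeRank_lt {C : Submodule K (ι → K)} {T : Finset ι}
    (h : codeRank C T < Module.finrank K C) : ∃ c ∈ vanishingOn C T, ∃ i, c i ≠ 0 := by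
  have h1 := codeRank_add_finrank_vanishingOn C T
  have h2 : vanishingOn C T ≠ ⊥ := by
    intro h0
    rw [h0, finrank_bot] at h1
    omega
  obtain ⟨c, hc, hne⟩ := (Submodule.ne_bot_iff _).1 h2
  exact ⟨c, hc, Function.ne_iff.1 hne⟩

variable [DecidableEq ι]

theorem codeRank_union_le (C : Submodule K (ι → K)) (S T : Finset ι) :
    codeRank C (S ∪ T) ≤ codeRank C S + codeRank C T := by
  have h1 := codeRank_add_finrank_vanishingOn C S
  have h2 := codeRank_add_finrank_vanishingOn C T
  have h3 := codeRank_add_finrank_vanishingOn C (S ∪ T)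
  have h4 := Submodule.finrank_sup_add_finrank_inf_eq (vanishingOn C S) (vanishingOn C T)
  have h5 : vanishingOn C S ⊓ vanishingOn C T = vanishingOn C (S ∪ T) := by
    ext c
    simp only [Submodule.mem_inf, mem_vanishingOn, Finset.mem_union]
    grind
  have h6 : Module.finrank K ↥(vanishingOn C S ⊔ vanishingOn C T) ≤ Module.finrank K C :=
    Submodule.finrank_mono (sup_le (fun _ h => h.1) fun _ h => h.1)
  rw [h5] at h4
  omega

theorem codeRank_lt_codeRank_union {C : Submodule K (ι → K)} {S T : Finset ι} :
    codeRank C T < codeRank C (T ∪ S) ↔ ∃ c ∈ vanishingOn C T, ∃ i ∈ S, c i ≠ 0 := by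
  constructor
  · intro h
    by_contra! hc
    refine h.not_ge (codeRank_le_of_vanishingOn_le fun c hcT => ⟨hcT.1, fun i hi => ?_⟩)
    rcases Finset.mem_union.1 hi with hi | hi
    exacts [hcT.2 i hi, hc c hcT i hi]
  · rintro ⟨c, hc, i, hi, hne⟩
    have h1 := codeRank_add_finrank_vanishingOn C T
    have h2 := codeRank_add_finrank_vanishingOn C (T ∪ S)
    have h3 : vanishingOn C (T ∪ S) < vanishingOn C T := by
      refine lt_of_le_of_ne (fun x hx => ⟨hx.1, fun i hi => hx.2 i ?_⟩) fun h => hne ?_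
      · exact Finset.mem_union_left _ hi
      · rw [← h] at hc
        exact hc.2 i (Finset.mem_union_right _ hi)
    have h4 := Submodule.finrank_lt_finrank_of_lt h3
    omega

/-! ### Repair sets and the bound on the minimum distance -/

/-- A set of coordinates of rank at most `r` on which any `δ - 1` erasures can be corrected. -/
structure IsRepairSet (C : Submodule K (ι → K)) (S : Finset ι) (r δ : ℕ) : Prop where
  codeRank_le : codeRank C S ≤ r
  vanishingOn_le : ∀ D ⊆ S, D.card < δ → vanishingOn C (S \ D) ≤ vanishingOn C S

theorem isRepairSet_image {κ : Type*} [Fintype κ] {C : Submodule K (ι → K)} {f : κ → ι}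
    (hf : Function.Injective f) {r δ : ℕ}
    (hr : Module.finrank K (C.map (LinearMap.funLeft K K f)) ≤ r)
    (hδ : MinDistGE (C.map (LinearMap.funLeft K K f)) δ) :
    IsRepairSet C (Finset.univ.image f) r δ := by
  refine ⟨?_, fun D hD hcard c hc => ⟨hc.1, ?_⟩⟩
  · have h1 := codeRank_add_finrank_vanishingOn C (Finset.univ.image f)
    have h2 := finrank_map_funLeft_add C f (T := Finset.univ.image f) (by simp)
    omega
  · by_contra! hne
    obtain ⟨i, hi, hne⟩ := hne
    obtain ⟨j, -, rfl⟩ := Finset.mem_image.1 hi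
    have h := hδ _ ⟨_, Submodule.mem_map_of_mem hc.1, fun h => hne (congrFun h j), rfl⟩
    refine hcard.not_ge (h.trans ?_)
    classical
    rw [hammingNorm]
    refine Finset.card_le_card_of_injOn f (fun j hj => ?_) hf.injOn
    by_contra hjD
    refine (Finset.mem_filter.1 hj).2 (hc.2 _ ?_)
    exact Finset.mem_sdiff.2 ⟨Finset.mem_image_of_mem _ (Finset.mem_univ _), hjD⟩

/-- Adjoining a repair set that is not spanned by `T` raises the nullity `|T| - rank T` by at least
`δ - 1`. -/
theorem IsRepairSet.codeRank_union_add_le {C : Submodule K (ι → K)} {S T : Finset ι} {r δ : ℕ}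
    (hS : IsRepairSet C S r δ) (hT : codeRank C T < codeRank C (T ∪ S)) :
    codeRank C (T ∪ S) + T.card + (δ - 1) ≤ codeRank C T + (T ∪ S).card := by
  have hcard : δ ≤ (S \ T).card := by
    by_contra! hlt
    obtain ⟨c, hc, i, hi, hne⟩ := codeRank_lt_codeRank_union.1 hT
    refine hne ((hS.vanishingOn_le _ Finset.sdiff_subset hlt ⟨hc.1, fun j hj => hc.2 j ?_⟩).2 i hi)
    grind
  -- The rank of `T ∪ S` is attained without `D`, so the points of `D` contribute to the nullity.
  obtain ⟨D, hD, hDcard⟩ := Finset.exists_subset_card_eq ((Nat.sub_le δ 1).trans hcard)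
  have h1 : codeRank C (T ∪ S) ≤ codeRank C (T ∪ ((S \ T) \ D)) := by
    rcases Nat.eq_zero_or_pos δ with rfl | hδ
    · have : D = ∅ := by simpa using hDcard
      exact codeRank_mono C (by grind)
    refine codeRank_le_of_vanishingOn_le fun c hc => ?_
    have h := hS.vanishingOn_le D (hD.trans Finset.sdiff_subset) (by omega)
      (show c ∈ vanishingOn C (S \ D) from ⟨hc.1, fun j hj => hc.2 j (by grind)⟩)
    refine ⟨hc.1, fun i hi => ?_⟩
    rcases Finset.mem_union.1 hi with hi | hi
    exacts [hc.2 i (Finset.mem_union_left _ hi), h.2 i hi]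
  have h2 := codeRank_union_le C T ((S \ T) \ D)
  have h3 := codeRank_le_card C ((S \ T) \ D)
  have h4 := Finset.card_sdiff_add_card_eq_card hD
  have h5 : (T ∪ S).card = T.card + (S \ T).card := by
    rw [← Finset.union_sdiff_self_eq_union, Finset.card_union_of_disjoint Finset.disjoint_sdiff]
  omega

/-- Every coordinate lies in a repair set for `(r₁, δ₁)` which is covered by repair sets for
`(r₂, δ₂)` contained in it. -/
def HasNestedRepair (C : Submodule K (ι → K)) (r₁ δ₁ r₂ δ₂ : ℕ) : Prop :=
  ∀ i, ∃ M : Finset ι, i ∈ M ∧ IsRepairSet C M r₁ δ₁ ∧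
    ∀ j ∈ M, ∃ L ⊆ M, j ∈ L ∧ IsRepairSet C L r₂ δ₂

theorem HasHierarchicalLocality.hasNestedRepair {C : Submodule K (ι → K)} {r₁ δ₁ r₂ δ₂ : ℕ}
    (h : HasHierarchicalLocality C r₁ δ₁ r₂ δ₂) : HasNestedRepair C r₁ δ₁ r₂ δ₂ := by
  intro i
  obtain ⟨S, hi, hr, hδ, hloc⟩ := h i
  refine ⟨Finset.univ.image (Subtype.val : S → ι), by simpa using hi,
    isRepairSet_image Subtype.val_injective hr hδ, fun j hj => ?_⟩
  obtain ⟨j, -, rfl⟩ := Finset.mem_image.1 hj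
  obtain ⟨L, hjL, hLr, hLδ⟩ := hloc j
  have hmap : punctured (punctured C S) L =
      C.map (LinearMap.funLeft K K ((Subtype.val : S → ι) ∘ (Subtype.val : L → S))) := by
    rw [punctured, punctured, ← Submodule.map_comp, ← LinearMap.funLeft_comp]
  rw [hmap] at hLr hLδ
  refine ⟨_, ?_, ?_,
    isRepairSet_image (Subtype.val_injective.comp Subtype.val_injective) hLr hLδ⟩
  · rw [← Finset.image_image]
    exact Finset.image_subset_image (Finset.subset_univ _)
  · exact Finset.mem_image.2 ⟨⟨j, hjL⟩, Finset.mem_univ _, rfl⟩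

theorem isRepairSet_univ {C : Submodule K (ι → K)} {r δ : ℕ}
    (hr : Module.finrank K C ≤ r) (hδ : MinDistGE C δ) : IsRepairSet C Finset.univ r δ := by
  have hid : C.map (LinearMap.funLeft K K (id : ι → ι)) = C := by
    exact Submodule.map_id C
  have h := isRepairSet_image (C := C) (f := id) Function.injective_id (r := r) (δ := δ)
    (by rwa [hid]) (by rwa [hid])
  rwa [Finset.image_id] at h

theorem HasLocality.hasNestedRepair {C : Submodule K (ι → K)} {r₁ δ₁ r₂ δ₂ : ℕ}
    (hr : Module.finrank K C ≤ r₁) (hδ : MinDistGE C δ₁) (h : HasLocality C r₂ δ₂) :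
    HasNestedRepair C r₁ δ₁ r₂ δ₂ := by
  refine fun i => ⟨Finset.univ, Finset.mem_univ _, isRepairSet_univ hr hδ, fun j _ => ?_⟩
  obtain ⟨L, hjL, hLr, hLδ⟩ := h j
  have hrep := isRepairSet_image Subtype.val_injective hLr hLδ
  exact ⟨_, Finset.subset_univ _, by simpa using hjL, hrep⟩

/-- The greedy construction.  The set `T` has been built by adjoining `l` local sets, and the middle
set `M` has not been exhausted yet.  A local set of `M` not spanned by `T` is adjoined; if it
completes `M` then all of `M` is adjoined instead, at the same rank but with the larger gain
`δ₁ - 1` of nullity, and a new middle set is started unless the rank of the code is reached. -/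
theorem exists_codeRank_lt_of_greedy {C : Submodule K (ι → K)} {r₁ δ₁ r₂ δ₂ : ℕ}
    (hC : HasNestedRepair C r₁ δ₁ r₂ δ₂) (hδ₂ : 0 < δ₂) (hδ : δ₂ ≤ δ₁) {A₁ A₂ : ℕ}
    (hA₁ : A₁ * r₁ < Module.finrank K C) (hA₂ : A₂ * r₂ < Module.finrank K C)
    (T M : Finset ι) (l m : ℕ) (hM : IsRepairSet C M r₁ δ₁)
    (hML : ∀ j ∈ M, ∃ L ⊆ M, j ∈ L ∧ IsRepairSet C L r₂ δ₂)
    (hlt : codeRank C T < codeRank C (T ∪ M)) (hm : codeRank C (T ∪ M) ≤ (m + 1) * r₁)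
    (hl : codeRank C T ≤ l * r₂)
    (hnull : codeRank C T + l * (δ₂ - 1) + m * (δ₁ - δ₂) ≤ T.card) :
    ∃ T' : Finset ι, codeRank C T' < Module.finrank K C ∧
      codeRank C T' + A₂ * (δ₂ - 1) + A₁ * (δ₁ - δ₂) ≤ T'.card := by
  have hle (U : Finset ι) : codeRank C U ≤ Module.finrank K C := by
    have := codeRank_add_finrank_vanishingOn C U
    omega
  obtain ⟨c, hc, i, hiM, hci⟩ := codeRank_lt_codeRank_union.1 hlt
  obtain ⟨L, hLM, hiL, hL⟩ := hML i hiM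
  have hltL : codeRank C T < codeRank C (T ∪ L) := codeRank_lt_codeRank_union.2 ⟨c, hc, i, hiL, hci⟩
  have hLl : codeRank C (T ∪ L) ≤ (l + 1) * r₂ := by
    have h1 := codeRank_union_le C T L
    have h2 := hL.codeRank_le
    rw [Nat.succ_mul]
    omega
  rcases (codeRank_mono C (Finset.union_subset_union_right hLM :
    T ∪ L ⊆ T ∪ M)).lt_or_eq with hcase | hcase
  · have hTLM : T ∪ L ∪ M = T ∪ M := by
      rw [Finset.union_assoc, Finset.union_eq_right.2 hLM]
    have hgain := hL.codeRank_union_add_le hltL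
    have := hle (T ∪ M)
    exact exists_codeRank_lt_of_greedy hC hδ₂ hδ hA₁ hA₂ (T ∪ L) M (l + 1) m hM hML
      (by rwa [hTLM]) (by rwa [hTLM]) hLl (by rw [Nat.succ_mul]; omega)
  · have hgain := hM.codeRank_union_add_le hlt
    rw [hcase] at hLl
    rcases (hle (T ∪ M)).lt_or_eq with hfull | hfull
    · obtain ⟨c', hc', i', hi'⟩ := exists_ne_zero_of_codeRank_lt hfull
      obtain ⟨M', hiM', hM', hML'⟩ := hC i'
      refine exists_codeRank_lt_of_greedy hC hδ₂ hδ hA₁ hA₂ (T ∪ M) M' (l + 1) (m + 1) hM' hML'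
        (codeRank_lt_codeRank_union.2 ⟨c', hc', i', hiM', hi'⟩) ?_ hLl ?_
      · have h1 := codeRank_union_le C (T ∪ M) M'
        have h2 := hM'.codeRank_le
        rw [Nat.succ_mul (m + 1)]
        omega
      · rw [Nat.succ_mul, Nat.succ_mul]
        omega
    · have h1 : A₁ ≤ m := Nat.lt_succ_iff.1 (lt_of_mul_lt_mul_right
        (hA₁.trans_le (hfull ▸ hm)) (Nat.zero_le _))
      have h2 : A₂ ≤ l := Nat.lt_succ_iff.1 (lt_of_mul_lt_mul_right
        (hA₂.trans_le (hfull ▸ hLl)) (Nat.zero_le _))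
      have h3 := Nat.mul_le_mul_right (δ₁ - δ₂) h1
      have h4 := Nat.mul_le_mul_right (δ₂ - 1) h2
      exact ⟨T, by omega, by omega⟩
termination_by Module.finrank K C - codeRank C T
decreasing_by all_goals omega

/-- A set of nullity at least `N` that does not span extends to a set of rank `dim C - 1` and
nullity at least `N`, on whose complement some nonzero codeword is supported. -/
theorem exists_mem_codeWeights_of_codeRank_lt {C : Submodule K (ι → K)} {N : ℕ} (T : Finset ι)
    (hT : codeRank C T < Module.finrank K C) (hN : codeRank C T + N ≤ T.card) :
    ∃ w ∈ codeWeights C, w + (Module.finrank K C - 1) + N ≤ Fintype.card ι := by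
  obtain ⟨c, hc, i, hci⟩ := exists_ne_zero_of_codeRank_lt hT
  by_cases hlast : codeRank C T + 1 < Module.finrank K C
  · have hi : i ∉ T := fun hi => hci (hc.2 i hi)
    have h1 := codeRank_union_le C T {i}
    have h2 := codeRank_le_card C {i}
    have h3 : codeRank C T < codeRank C (T ∪ {i}) :=
      codeRank_lt_codeRank_union.2 ⟨c, hc, i, by simp, hci⟩
    have h4 : (T ∪ {i}).card = T.card + 1 := by
      rw [Finset.card_union_of_disjoint (by simpa using hi), Finset.card_singleton]
    rw [Finset.card_singleton] at h2
    exact exists_mem_codeWeights_of_codeRank_lt (T ∪ {i}) (by omega) (by omega)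
  · classical
    refine ⟨hammingNorm c, ⟨c, hc.1, fun h => hci (congrFun h i), by congr⟩, ?_⟩
    have h1 : hammingNorm c ≤ Tᶜ.card := by
      refine Finset.card_le_card fun j hj => ?_
      exact Finset.mem_compl.2 fun hjT => (Finset.mem_filter.1 hj).2 (hc.2 j hjT)
    have h2 := Finset.card_compl_add_card T
    omega
termination_by Module.finrank K C - codeRank C T
decreasing_by omega

/-- The Singleton-type bound for codes with hierarchical locality. -/
theorem HasNestedRepair.exists_mem_codeWeights {C : Submodule K (ι → K)} {r₁ δ₁ r₂ δ₂ : ℕ}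
    (hC : HasNestedRepair C r₁ δ₁ r₂ δ₂) (hδ₂ : 0 < δ₂) (hδ : δ₂ ≤ δ₁) {A₁ A₂ : ℕ}
    (hA₁ : A₁ * r₁ < Module.finrank K C) (hA₂ : A₂ * r₂ < Module.finrank K C) :
    ∃ w ∈ codeWeights C, w + (Module.finrank K C - 1) + (A₂ * (δ₂ - 1) + A₁ * (δ₁ - δ₂)) ≤
      Fintype.card ι := by
  have h0 : codeRank C ∅ = 0 := by simpa using codeRank_le_card C ∅
  obtain ⟨c, hc, i, hi⟩ := exists_ne_zero_of_codeRank_lt (C := C) (T := ∅) (by omega)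
  obtain ⟨M, hiM, hM, hML⟩ := hC i
  obtain ⟨T, hT, hN⟩ := exists_codeRank_lt_of_greedy hC hδ₂ hδ hA₁ hA₂ ∅ M 0 0 hM hML
    (codeRank_lt_codeRank_union.2 ⟨c, hc, i, hiM, hi⟩) (by simpa using hM.codeRank_le)
    (by simp [h0]) (by simp [h0])
  exact exists_mem_codeWeights_of_codeRank_lt T hT (by omega)

end Rank

/-! ### Exponent sets -/

section Exponents

theorem mem_translates {S : Finset ℕ} {s μ x : ℕ} :
    x ∈ translates S s μ ↔ ∃ j < μ, ∃ e ∈ S, j * s + e = x := by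
  simp [translates]

theorem trunc_range {n r : ℕ} (h : r ≤ n) : trunc (Finset.range n) r = Finset.range r := by
  ext x
  simp only [trunc, Finset.mem_filter, Finset.mem_range]
  constructor
  · rintro ⟨hx, hc⟩
    have : (Finset.range n).filter (· < x) = Finset.range x := by
      ext y
      simp only [Finset.mem_filter, Finset.mem_range]
      omega
    rwa [this, Finset.card_range] at hc
  · intro hx
    refine ⟨hx.trans_le h, lt_of_le_of_lt (Finset.card_le_card fun y hy => ?_)
      ((Finset.card_range x).trans_lt hx)⟩
    exact Finset.mem_range.2 (Finset.mem_filter.1 hy).2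

theorem card_translates {S : Finset ℕ} {s : ℕ} (hS : S ⊆ Finset.range s) (μ : ℕ) :
    (translates S s μ).card = μ * S.card := by
  rw [translates, Finset.card_biUnion]
  · simp [Finset.card_image_of_injective _ (add_right_injective _)]
  · intro i _ j _ hij
    refine Finset.disjoint_left.2 fun x hx hx' => hij ?_
    obtain ⟨e, he, rfl⟩ := Finset.mem_image.1 hx
    obtain ⟨e', he', h⟩ := Finset.mem_image.1 hx'
    have h1 := Finset.mem_range.1 (hS he)
    have h2 := Finset.mem_range.1 (hS he')
    have h3 : (s * i + e) / s = (s * j + e') / s := by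
      rw [mul_comm s i, mul_comm s j, h]
    rwa [Nat.mul_add_div (by omega), Nat.mul_add_div (by omega), Nat.div_eq_of_lt h1,
      Nat.div_eq_of_lt h2] at h3

theorem translates_subset_range {S : Finset ℕ} {s B μ : ℕ} (hS : S ⊆ Finset.range B) :
    translates S s μ ⊆ Finset.range ((μ - 1) * s + B) := by
  intro x hx
  obtain ⟨j, hj, e, he, rfl⟩ := mem_translates.1 hx
  have h1 := Finset.mem_range.1 (hS he)
  have h2 : j * s ≤ (μ - 1) * s := Nat.mul_le_mul_right _ (by omega)
  exact Finset.mem_range.2 (by omega)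

theorem translates_mono_right {S : Finset ℕ} {s a μ : ℕ} (h : a ≤ μ) :
    translates S s a ⊆ translates S s μ :=
  Finset.biUnion_subset_biUnion_of_subset_left _ (Finset.range_subset_range.2 h)

/-- Truncating a union of translates of a set to a multiple of its size keeps whole translates. -/
theorem trunc_translates {S : Finset ℕ} {s a μ : ℕ} (hS : S ⊆ Finset.range s) (ha : a ≤ μ) :
    trunc (translates S s μ) (a * S.card) = translates S s a := by
  have hlt {e : ℕ} (he : e ∈ S) : e < s := Finset.mem_range.1 (hS he)
  ext x
  rw [trunc, Finset.mem_filter]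
  constructor
  · rintro ⟨hx, hc⟩
    obtain ⟨j, hj, e, he, rfl⟩ := mem_translates.1 hx
    refine mem_translates.2 ⟨j, ?_, e, he, rfl⟩
    by_contra! haj
    refine hc.not_ge ?_
    rw [← card_translates hS]
    refine Finset.card_le_card fun y hy => ?_
    refine Finset.mem_filter.2 ⟨translates_mono_right ha hy, ?_⟩
    obtain ⟨j', hj', e', he', rfl⟩ := mem_translates.1 hy
    have h1 := hlt he'
    have h2 : (j' + 1) * s ≤ j * s := Nat.mul_le_mul_right _ (by omega)
    rw [Nat.succ_mul] at h2
    omega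
  · intro hx
    refine ⟨translates_mono_right ha hx, ?_⟩
    rw [← card_translates hS]
    refine Finset.card_lt_card ((Finset.ssubset_iff_of_subset fun y hy => ?_).2 ⟨x, hx, by simp⟩)
    obtain ⟨hyT, hyx⟩ := Finset.mem_filter.1 hy
    obtain ⟨j, hj, e, he, rfl⟩ := mem_translates.1 hx
    obtain ⟨j', -, e', he', rfl⟩ := mem_translates.1 hyT
    refine mem_translates.2 ⟨j', ?_, e', he', rfl⟩
    by_contra! haj
    have h1 := hlt he
    have h2 : (j + 1) * s ≤ j' * s := Nat.mul_le_mul_right _ (by omega)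
    rw [Nat.succ_mul] at h2
    omega

theorem CodeParams.exp₂_eq_range {P : CodeParams} (h : P.r₂ ≤ P.n₂) :
    P.exp₂ = Finset.range P.r₂ :=
  trunc_range h

theorem CodeParams.exp₁_eq_translates {P : CodeParams} (hr₂ : P.r₂ ≤ P.n₂) {a : ℕ}
    (ha : a ≤ P.numLocal) (hr₁ : P.r₁ = a * P.r₂) : P.exp₁ = translates P.exp₂ P.n₂ a := by
  rw [exp₁, preExp₁, exp₂_eq_range hr₂, hr₁]
  simpa using trunc_translates (Finset.range_subset_range.2 hr₂) ha

end Exponents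

/-! ### Evaluation codes with prescribed exponents -/

section MonomialCode

variable {F : Type*} [Field F] {κ : Type*}

/-- The code of the evaluations at the points `x i` of the polynomials whose exponents lie in
`E`. -/
def monomialCode (E : Finset ℕ) (x : κ → F) : Submodule F (κ → F) :=
  Submodule.span F (Set.range fun (e : E) (i : κ) => x i ^ (e : ℕ))

theorem mem_monomialCode_iff {E : Finset ℕ} {x : κ → F} {c : κ → F} :
    c ∈ monomialCode E x ↔ ∃ f : F[X], f.support ⊆ E ∧ ∀ i, c i = f.eval (x i) := by
  constructor
  · intro hc
    refine Submodule.span_induction ?_ ⟨0, by simp⟩ ?_ ?_ hc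
    · rintro _ ⟨e, rfl⟩
      refine ⟨X ^ (e : ℕ), ?_, fun i => by simp⟩
      rw [support_X_pow _ ]
      simp
    · rintro _ _ _ _ ⟨f, hf, hc⟩ ⟨g, hg, hd⟩
      exact ⟨f + g, support_add.trans (Finset.union_subset hf hg), fun i => by simp [hc, hd]⟩
    · rintro a _ _ ⟨f, hf, hc⟩
      exact ⟨a • f, (support_smul a f).trans hf, fun i => by simp [hc]⟩
  · rintro ⟨f, hf, hc⟩
    have : c = ∑ e ∈ f.support, f.coeff e • fun i => x i ^ e := by
      ext i
      simp [hc, eval_eq_sum, Polynomial.sum]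
    rw [this]
    exact Submodule.sum_mem _ fun e he =>
      Submodule.smul_mem _ _ (Submodule.subset_span ⟨⟨e, hf he⟩, rfl⟩)

theorem punctured_monomialCode (E : Finset ℕ) (x : κ → F) (S : Finset κ) :
    punctured (monomialCode E x) S = monomialCode E fun i : S => x i := by
  rw [punctured, monomialCode, Submodule.map_span, monomialCode, ← Set.range_comp]
  rfl

/-- On a set of points with a common `m`-th power, the exponents matter only up to translation by
multiples of `m`. -/
theorem monomialCode_translates {S : Finset ℕ} {m μ : ℕ} {x : κ → F} {g : F}
    (hx : ∀ i, x i ^ m = g) (hμ : 0 < μ) :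
    monomialCode (translates S m μ) x = monomialCode S x := by
  apply le_antisymm <;> refine Submodule.span_le.2 ?_
  · rintro _ ⟨⟨_, htr⟩, rfl⟩
    obtain ⟨j, -, e, he, rfl⟩ := mem_translates.1 htr
    have : (fun i => x i ^ (j * m + e)) = g ^ j • fun i => x i ^ e := by
      ext i
      rw [Pi.smul_apply, smul_eq_mul, ← hx i, pow_add, mul_comm j, pow_mul]
    change (fun i => x i ^ (j * m + e)) ∈ monomialCode S x
    rw [this]
    exact Submodule.smul_mem _ _ (Submodule.subset_span ⟨⟨e, he⟩, rfl⟩)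
  · rintro _ ⟨⟨e, he⟩, rfl⟩
    exact Submodule.subset_span ⟨⟨e, mem_translates.2 ⟨0, hμ, e, he, by simp⟩⟩, rfl⟩

theorem eq_zero_of_support_subset_range {f : F[X]} {x : κ → F} (hx : Function.Injective x)
    {B : ℕ} (hf : f.support ⊆ Finset.range B) {Z : Finset κ} (hZ : B ≤ Z.card)
    (h0 : ∀ i ∈ Z, f.eval (x i) = 0) : f = 0 := by
  refine eq_zero_of_degree_lt_of_eval_index_eq_zero Z hx.injOn ?_ h0
  refine (degree_lt_iff_coeff_zero _ _).2 fun e he => ?_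
  by_contra hne
  have := Finset.mem_range.1 (hf (mem_support_iff.2 hne))
  omega

section Fintype

variable [Fintype κ]

theorem finrank_monomialCode {E : Finset ℕ} {x : κ → F} (hx : Function.Injective x)
    (hE : E ⊆ Finset.range (Fintype.card κ)) :
    Module.finrank F (monomialCode E x) = E.card := by
  rw [monomialCode, finrank_span_eq_card, Fintype.card_coe]
  refine Fintype.linearIndependent_iff.2 fun g hg e => ?_
  have hcoeff (d : ℕ) : (∑ e : E, monomial (e : ℕ) (g e)).coeff d =
      ∑ e : E, if (e : ℕ) = d then g e else 0 := by
    simp [finsetSum_coeff, coeff_monomial]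
  have h0 : ∑ e : E, monomial (e : ℕ) (g e) = 0 := by
    refine eq_zero_of_support_subset_range hx (B := Fintype.card κ) (Z := Finset.univ)
      (fun d hd => ?_) le_rfl fun i _ => ?_
    · obtain ⟨e, -, he⟩ := Finset.exists_ne_zero_of_sum_ne_zero
        ((hcoeff d).symm.trans_ne (mem_support_iff.1 hd))
      obtain rfl : (e : ℕ) = d := by
        by_contra hne
        simp [hne] at he
      exact hE e.2
    · simpa [eval_finsetSum] using congrFun hg i
  have h1 := hcoeff e
  rw [h0, coeff_zero] at h1
  simpa [Subtype.coe_inj] using h1.symm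

theorem minDistGE_monomialCode {E : Finset ℕ} {x : κ → F} (hx : Function.Injective x) {B : ℕ}
    (hE : E ⊆ Finset.range B) : MinDistGE (monomialCode E x) (Fintype.card κ + 1 - B) := by
  classical
  rintro w ⟨c, hc, hne, rfl⟩
  obtain ⟨f, hf, hcf⟩ := mem_monomialCode_iff.1 hc
  by_contra! hlt
  refine hne ?_
  have h1 := Finset.card_filter_add_card_filter_not (s := (Finset.univ : Finset κ))
    (fun i => c i ≠ 0)
  have h2 : (Finset.univ.filter fun i => c i ≠ 0).card < Fintype.card κ + 1 - B := by
    refine lt_of_eq_of_lt ?_ hlt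
    rw [hammingNorm]
  rw [Finset.card_univ] at h1
  have h0 : f = 0 := eq_zero_of_support_subset_range hx (hf.trans hE)
    (Z := Finset.univ.filter fun i => ¬ c i ≠ 0) (by omega) fun i hi => by
      have := (Finset.mem_filter.1 hi).2
      rw [← hcf]
      simpa using this
  ext i
  simp [hcf, h0]

theorem isLeast_codeWeights {C : Submodule F (κ → F)} {d w : ℕ} (hd : MinDistGE C d)
    (hw : w ∈ codeWeights C) (hwd : w ≤ d) : IsLeast (codeWeights C) d :=
  ⟨le_antisymm hwd (hd w hw) ▸ hw, fun v hv => hd v hv⟩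

end Fintype

/-- The fibres of the `m`-th power map are the repair sets of a code whose exponents are translates
of `{0, …, r - 1}` by multiples of `m`. -/
theorem hasLocality_monomialCode {x : κ → F} (hx : Function.Injective x) {m r a : ℕ} (ha : 0 < a)
    (hfib : ∀ i, ∃ S : Finset κ, i ∈ S ∧ S.card = m ∧ ∀ j ∈ S, x j ^ m = x i ^ m) (hr : r ≤ m) :
    HasLocality (monomialCode (translates (Finset.range r) m a) x) r (m + 1 - r) := by
  intro i
  obtain ⟨S, hi, hcard, hS⟩ := hfib i
  have hxS : Function.Injective fun j : S => x j := hx.comp Subtype.val_injective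
  have hcard' : Fintype.card S = m := by rw [Fintype.card_coe, hcard]
  rw [← hcard'] at hr
  refine ⟨S, hi, ?_⟩
  rw [punctured_monomialCode, monomialCode_translates (g := x i ^ m) (fun j : S => hS j j.2) ha]
  constructor
  · rw [finrank_monomialCode hxS (Finset.range_subset_range.2 hr), Finset.card_range]
  · have h := minDistGE_monomialCode hxS (Finset.Subset.refl (Finset.range r))
    rwa [hcard'] at h

end MonomialCode

/-! ### Cosets and interpolation -/

namespace HierCode

section Interpolation

variable {F : Type*} [Field F]

theorem mem_coset [DecidableEq F] {γ β x : F} {m : ℕ} (hγ : γ ≠ 0) (hβ : orderOf β = m)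
    (hm : 0 < m) : x ∈ coset γ β m ↔ x ^ m = γ ^ m := by
  subst hβ
  rw [coset, Finset.mem_image]
  constructor
  · rintro ⟨e, -, rfl⟩
    rw [mul_pow, ← pow_mul, mul_comm e, pow_mul, pow_orderOf_eq_one, one_pow, mul_one]
  · intro h
    have : NeZero (orderOf β) := ⟨hm.ne'⟩
    obtain ⟨e, he, hx⟩ := (IsPrimitiveRoot.orderOf β).eq_pow_of_pow_eq_one (ξ := x / γ)
      (by rw [div_pow, h, div_self (pow_ne_zero _ hγ)])
    exact ⟨e, Finset.mem_range.2 he, by rw [hx, mul_div_cancel₀ x hγ]⟩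

theorem card_coset [DecidableEq F] {γ β : F} {m : ℕ} (hγ : γ ≠ 0) (hβ : orderOf β = m) :
    (coset γ β m).card = m := by
  rw [coset, Finset.card_image_of_injOn, Finset.card_range]
  intro e he e' he' h
  rw [Finset.mem_coe, Finset.mem_range, ← hβ] at he he'
  exact pow_injOn_Iio_orderOf he he' (mul_left_cancel₀ hγ h)

theorem injOn_node {α β : F} {m μ : ℕ} (hα : α ≠ 0) (hm : 0 < m) (hμ : μ * m ≤ orderOf β) :
    Set.InjOn (fun b => (α * β ^ b) ^ m) (Finset.range μ) := by
  intro b hb b' hb' h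
  rw [Finset.mem_coe, Finset.mem_range] at hb hb'
  simp only [mul_pow, ← pow_mul] at h
  have hlt {c : ℕ} (hc : c < μ) : c * m < orderOf β :=
    ((Nat.mul_lt_mul_right hm).2 hc).trans_le hμ
  exact Nat.eq_of_mul_eq_mul_right hm
    (pow_injOn_Iio_orderOf (hlt hb) (hlt hb') (mul_left_cancel₀ (pow_ne_zero m hα) h))

/-- The polynomials `E` are the Lagrange basis polynomials in `X ^ m` of the nodes `γ s ^ m`. -/
theorem idem_eq_expand (γ : ℕ → F) (m μ t : ℕ) :
    idem γ m μ t = expand F m (Lagrange.basis (Finset.range μ) (fun s => γ s ^ m) t) := by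
  simp [idem, Lagrange.basis, Lagrange.basisDivisor, map_prod, expand_C, expand_X]

theorem support_mul_idem {γ : ℕ → F} {m μ t : ℕ}
    (hγ : Set.InjOn (fun s => γ s ^ m) (Finset.range μ)) (ht : t < μ) {S : Finset ℕ} {f : F[X]}
    (hf : f.support ⊆ S) : (f * idem γ m μ t).support ⊆ translates S m μ := by
  have hdeg := Lagrange.natDegree_basis hγ (Finset.mem_range.2 ht)
  rw [Finset.card_range] at hdeg
  intro x hx
  rw [idem_eq_expand, expand_eq_sum, Polynomial.sum, Finset.mul_sum, mem_support_iff,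
    finsetSum_coeff] at hx
  obtain ⟨j, hj, hne⟩ := Finset.exists_ne_zero_of_sum_ne_zero hx
  rw [mul_left_comm, coeff_C_mul, ← pow_mul, coeff_mul_X_pow'] at hne
  have hle : m * j ≤ x := by
    by_contra h
    simp [h] at hne
  rw [if_pos hle] at hne
  have h1 := le_natDegree_of_mem_supp j hj
  refine mem_translates.2 ⟨j, by omega, x - m * j,
    hf (mem_support_iff.2 (right_ne_zero_of_mul hne)), ?_⟩
  rw [mul_comm j]
  omega

theorem sum_mul_idem {γ : ℕ → F} {m μ j : ℕ}
    (hγ : Set.InjOn (fun s => γ s ^ m) (Finset.range μ)) (hj : j < μ) (f : F[X]) :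
    ∑ t ∈ Finset.range μ, (C ((γ t ^ m) ^ j) * f) * idem γ m μ t = X ^ (j * m) * f := by
  have h := Lagrange.eq_interpolate (f := (X ^ j : F[X])) hγ
    (by rw [degree_X_pow, Finset.card_range]; exact_mod_cast hj)
  have h' := congrArg (expand F m) h
  rw [Lagrange.interpolate_apply, map_sum, map_pow, expand_X, ← pow_mul, mul_comm m] at h'
  rw [h', Finset.sum_mul]
  refine Finset.sum_congr rfl fun t _ => ?_
  rw [idem_eq_expand, map_mul, expand_C, eval_pow, eval_X]
  ring

end Interpolation

/-! ### The code as an evaluation code -/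

section Code

variable {F : Type*} [Field F] {P : CodeParams} {β₀ β₁ : F}

theorem support_poly₁
    (hγ : ∀ t < P.numMiddle,
      Set.InjOn (fun b => (β₀ ^ t * β₁ ^ b) ^ P.n₂) (Finset.range P.numLocal))
    (hr₂ : P.r₂ ≤ P.n₂) {u : ℕ → ℕ → F[X]} (hu : IsPrecoded P β₀ β₁ u) {t : ℕ}
    (ht : t < P.numMiddle) : (poly₁ P β₀ β₁ u t).support ⊆ P.exp₁ := by
  have h : (poly₁ P β₀ β₁ u t).support ⊆ P.preExp₁ := by
    intro x hx
    rw [poly₁, mem_support_iff, finsetSum_coeff] at hx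
    obtain ⟨s, hs, hne⟩ := Finset.exists_ne_zero_of_sum_ne_zero hx
    rw [Finset.mem_range] at hs
    refine support_mul_idem (hγ t ht) hs ?_ (mem_support_iff.2 hne)
    intro e he
    rw [CodeParams.exp₂_eq_range hr₂, Finset.mem_range]
    exact_mod_cast (le_degree_of_mem_supp e he).trans_lt (hu.degree_lt t ht s hs)
  intro x hx
  by_contra hne
  exact mem_support_iff.1 hx (hu.level₁ t ht x (Finset.mem_sdiff.2 ⟨h hx, hne⟩))

theorem support_poly₀
    (hγ₀ : Set.InjOn (fun a => (β₀ ^ a) ^ P.n₁) (Finset.range P.numMiddle))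
    (hγ : ∀ t < P.numMiddle,
      Set.InjOn (fun b => (β₀ ^ t * β₁ ^ b) ^ P.n₂) (Finset.range P.numLocal))
    (hr₂ : P.r₂ ≤ P.n₂) {u : ℕ → ℕ → F[X]} (hu : IsPrecoded P β₀ β₁ u) :
    (poly₀ P β₀ β₁ u).support ⊆ P.exp₀ := by
  have h : (poly₀ P β₀ β₁ u).support ⊆ P.preExp₀ := by
    intro x hx
    rw [poly₀, mem_support_iff, finsetSum_coeff] at hx
    obtain ⟨t, ht, hne⟩ := Finset.exists_ne_zero_of_sum_ne_zero hx
    rw [Finset.mem_range] at ht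
    exact support_mul_idem hγ₀ ht (support_poly₁ hγ hr₂ hu ht) (mem_support_iff.2 hne)
  intro x hx
  by_contra hne
  exact mem_support_iff.1 hx (hu.level₀ x (Finset.mem_sdiff.2 ⟨h hx, hne⟩))

/-- Every monomial with exponent in `exp₀` is a code polynomial: the powers of `X ^ n₁` and of
`X ^ n₂` are interpolated by their values on the cosets. -/
theorem exists_isPrecoded
    (hγ₀ : Set.InjOn (fun a => (β₀ ^ a) ^ P.n₁) (Finset.range P.numMiddle))
    (hγ : ∀ t < P.numMiddle,
      Set.InjOn (fun b => (β₀ ^ t * β₁ ^ b) ^ P.n₂) (Finset.range P.numLocal))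
    (hr₂ : P.r₂ ≤ P.n₂) {e : ℕ} (he : e ∈ P.exp₀) :
    ∃ u, IsPrecoded P β₀ β₁ u ∧ poly₀ P β₀ β₁ u = X ^ e := by
  obtain ⟨j, hj, e₁, he₁, hje⟩ := mem_translates.1 (Finset.mem_filter.1 he).1
  obtain ⟨j', hj', i, hi, hji⟩ := mem_translates.1 (Finset.mem_filter.1 he₁).1
  rw [CodeParams.exp₂_eq_range hr₂, Finset.mem_range] at hi
  let u : ℕ → ℕ → F[X] := fun t s =>
    C (((β₀ ^ t * β₁ ^ s) ^ P.n₂) ^ j') * (C (((β₀ ^ t) ^ P.n₁) ^ j) * X ^ i)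
  have h₁ (t : ℕ) (ht : t < P.numMiddle) :
      poly₁ P β₀ β₁ u t = C (((β₀ ^ t) ^ P.n₁) ^ j) * X ^ e₁ := by
    rw [poly₁]
    refine (sum_mul_idem (hγ t ht) hj' _).trans ?_
    rw [← hji, pow_add]
    ring
  have h₀ : poly₀ P β₀ β₁ u = X ^ e := by
    rw [← hje, pow_add, ← sum_mul_idem hγ₀ hj]
    exact Finset.sum_congr rfl fun t ht => by rw [h₁ t (Finset.mem_range.1 ht), E₁]
  refine ⟨u, ⟨fun t _ s _ => ?_, fun t ht d hd => ?_, fun d hd => ?_⟩, h₀⟩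
  · simp only [u]
    rw [← mul_assoc, ← C_mul]
    exact (degree_C_mul_X_pow_le _ _).trans_lt (by exact_mod_cast hi)
  · rw [h₁ t ht, coeff_C_mul_X_pow, if_neg]
    rintro rfl
    exact (Finset.mem_sdiff.1 hd).2 he₁
  · rw [h₀, coeff_X_pow, if_neg]
    rintro rfl
    exact (Finset.mem_sdiff.1 hd).2 he

theorem code_eq_monomialCode [DecidableEq F]
    (hγ₀ : Set.InjOn (fun a => (β₀ ^ a) ^ P.n₁) (Finset.range P.numMiddle))
    (hγ : ∀ t < P.numMiddle,
      Set.InjOn (fun b => (β₀ ^ t * β₁ ^ b) ^ P.n₂) (Finset.range P.numLocal))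
    (hr₂ : P.r₂ ≤ P.n₂) :
    code P β₀ β₁ = monomialCode P.exp₀ fun θ : evalSet P β₀ β₁ => (θ : F) := by
  apply le_antisymm
  · rintro c ⟨u, hu, hc⟩
    exact mem_monomialCode_iff.2 ⟨_, support_poly₀ hγ₀ hγ hr₂ hu, hc⟩
  · refine Submodule.span_le.2 ?_
    rintro _ ⟨⟨e, he⟩, rfl⟩
    obtain ⟨u, hu, h⟩ := exists_isPrecoded hγ₀ hγ hr₂ he
    exact ⟨u, hu, fun θ => by simp [h]⟩

end Code

end HierCode

/-! ### Parameters of the global, middle and local codes -/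

/-- A code whose guaranteed distance `d` meets the bound for its hierarchical locality has minimum
distance exactly `d`. -/
theorem HasNestedRepair.isLinearCode {K : Type*} [Field K] {ι : Type*} [Fintype ι] [DecidableEq ι]
    {C : Submodule K (ι → K)} {n k d r₁ δ₁ r₂ δ₂ : ℕ} (hC : HasNestedRepair C r₁ δ₁ r₂ δ₂)
    (hn : Fintype.card ι = n) (hk : Module.finrank K C = k) (hd : MinDistGE C d)
    (hδ₂ : 0 < δ₂) (hδ : δ₂ ≤ δ₁) {A₁ A₂ : ℕ} (hA₁ : A₁ * r₁ < k) (hA₂ : A₂ * r₂ < k)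
    (hle : n ≤ d + (k - 1) + (A₂ * (δ₂ - 1) + A₁ * (δ₁ - δ₂))) : IsLinearCode C n k d := by
  subst hn hk
  obtain ⟨w, hw, hwle⟩ := hC.exists_mem_codeWeights hδ₂ hδ hA₁ hA₂
  exact ⟨rfl, rfl, isLeast_codeWeights hd hw (by omega)⟩

section

variable {F : Type*} [Field F] {κ : Type*} [Fintype κ] {x : κ → F}

/-- The local codes are Reed-Solomon codes. -/
theorem isLinearCode_monomialCode_range [DecidableEq κ] (hx : Function.Injective x) {r q : ℕ}
    (hr : 0 < r) (hκ : Fintype.card κ = r + q) :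
    IsLinearCode (monomialCode (Finset.range r) x) (r + q) r (q + 1) := by
  have hfin : Module.finrank F (monomialCode (Finset.range r) x) = r := by
    rw [finrank_monomialCode hx (Finset.range_subset_range.2 (by omega)), Finset.card_range]
  have hdist : MinDistGE (monomialCode (Finset.range r) x) (q + 1) := by
    have h := minDistGE_monomialCode hx (Finset.Subset.refl (Finset.range r))
    rwa [hκ, show r + q + 1 - r = q + 1 by omega] at h
  have hrep := isRepairSet_univ hfin.le hdist
  have hC : HasNestedRepair (monomialCode (Finset.range r) x) r (q + 1) r (q + 1) :=
    fun _ => ⟨_, Finset.mem_univ _, hrep, fun j _ =>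
      ⟨_, Finset.Subset.refl _, Finset.mem_univ j, hrep⟩⟩
  exact hC.isLinearCode (A₁ := 0) (A₂ := 0) hκ hfin hdist (by omega) le_rfl (by omega) (by omega)
    (by omega)

/-- The middle codes, for `a + 1` translates of the local exponents. -/
theorem isLinearCode_monomialCode_translates [DecidableEq κ] (hx : Function.Injective x)
    {r q a p : ℕ} (hr : 0 < r) (hκ : Fintype.card κ = (a + 1) * (r + q) + p)
    (hloc : HasLocality (monomialCode (translates (Finset.range r) (r + q) (a + 1)) x) r (q + 1)) :
    IsLinearCode (monomialCode (translates (Finset.range r) (r + q) (a + 1)) x)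
      ((a + 1) * (r + q) + p) ((a + 1) * r) (p + q + 1) := by
  have hrange : Finset.range r ⊆ Finset.range (r + q) := Finset.range_subset_range.2 (by omega)
  have hE := translates_subset_range (s := r + q) (μ := a + 1) (Finset.Subset.refl (Finset.range r))
  have hfin : Module.finrank F (monomialCode (translates (Finset.range r) (r + q) (a + 1)) x) =
      (a + 1) * r := by
    rw [finrank_monomialCode hx, card_translates hrange, Finset.card_range]
    refine hE.trans (Finset.range_subset_range.2 ?_)
    rw [hκ, Nat.add_sub_cancel, Nat.succ_mul]
    omega
  have hdist : MinDistGE (monomialCode (translates (Finset.range r) (r + q) (a + 1)) x)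
      (p + q + 1) := by
    have h := minDistGE_monomialCode hx hE
    rwa [hκ, Nat.sub_eq_of_eq_add (c := p + q + 1) (by rw [Nat.add_sub_cancel]; ring)] at h
  have hC := hloc.hasNestedRepair hfin.le hdist
  refine hC.isLinearCode (A₁ := 0) (A₂ := a) hκ hfin hdist (by omega) (by omega) ?_ ?_ ?_
  · rw [zero_mul]; positivity
  · rw [Nat.succ_mul]; omega
  · rw [Nat.add_sub_cancel, zero_mul, mul_add, Nat.succ_mul, Nat.succ_mul]
    have : 0 < a * r + r := by positivity
    omega

end

namespace HierCode

variable {F : Type*} [Field F] [DecidableEq F] {P : CodeParams} {β₀ β₁ β₂ : F}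

theorem card_coords {S : Finset F} (hS : S ⊆ evalSet P β₀ β₁) :
    Fintype.card (coords P β₀ β₁ S) = S.card := by
  rw [Fintype.card_coe, coords, Finset.card_subtype, Finset.filter_true_of_mem fun x hx => hS hx]

theorem mem_coords {S : Finset F} {θ : evalSet P β₀ β₁} : θ ∈ coords P β₀ β₁ S ↔ (θ : F) ∈ S :=
  Finset.mem_subtype

theorem middleSet_subset_evalSet {t : ℕ} (ht : t < P.numMiddle) :
    middleSet P β₀ β₁ t ⊆ evalSet P β₀ β₁ :=
  Finset.subset_biUnion_of_mem (fun t => middleSet P β₀ β₁ t) (Finset.mem_range.2 ht)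

theorem card_evalSet (hβ₀ : β₀ ≠ 0) (hn₁ : 0 < P.n₁) (hβ₁ : orderOf β₁ = P.n₁)
    (hγ₀ : Set.InjOn (fun a => (β₀ ^ a) ^ P.n₁) (Finset.range P.numMiddle)) :
    (evalSet P β₀ β₁).card = P.numMiddle * P.n₁ := by
  rw [evalSet, Finset.card_biUnion]
  · simp [middleSet, card_coset (pow_ne_zero _ hβ₀) hβ₁]
  · intro t ht t' ht' hne
    refine Finset.disjoint_left.2 fun x hx hx' => hne (hγ₀ ht ht' ?_)
    have hmem {t : ℕ} (h : x ∈ middleSet P β₀ β₁ t) : x ^ P.n₁ = (β₀ ^ t) ^ P.n₁ :=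
      (mem_coset (pow_ne_zero _ hβ₀) hβ₁ hn₁).1 h
    exact (hmem hx).symm.trans (hmem hx')

theorem localSet_subset_middleSet (hβ₀ : β₀ ≠ 0) (hn₁ : 0 < P.n₁) (hn₂ : P.n₂ ∣ P.n₁)
    (hβ₁ : orderOf β₁ = P.n₁) (hβ₂ : orderOf β₂ = P.n₂) (t s : ℕ) :
    localSet P β₀ β₁ β₂ t s ⊆ middleSet P β₀ β₁ t := by
  have hβ₁0 : β₁ ≠ 0 := by
    rintro rfl
    simp at hβ₁
    omega
  intro x hx
  rw [localSet, mem_coset (mul_ne_zero (pow_ne_zero _ hβ₀) (pow_ne_zero _ hβ₁0)) hβ₂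
    (Nat.pos_of_dvd_of_pos hn₂ hn₁)] at hx
  rw [middleSet, mem_coset (pow_ne_zero _ hβ₀) hβ₁ hn₁]
  obtain ⟨μ, hμ⟩ := hn₂
  have h1 : (β₁ ^ s) ^ P.n₁ = 1 := by
    rw [← pow_mul, mul_comm, pow_mul, ← hβ₁, pow_orderOf_eq_one, one_pow]
  have h2 := congrArg (· ^ μ) hx
  simp only [← pow_mul, ← hμ] at h2
  rw [h2, mul_pow, h1, mul_one]

/-- Inside a middle set, the fibres of the `n₂`-th power map are cosets of size `n₂`. -/
theorem exists_fibre (hβ₀ : β₀ ≠ 0) (hn₁ : 0 < P.n₁) (hn₂ : P.n₂ ∣ P.n₁)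
    (hβ₁ : orderOf β₁ = P.n₁) (hβ₂ : orderOf β₂ = P.n₂) {t : ℕ} (ht : t < P.numMiddle)
    (i : coords P β₀ β₁ (middleSet P β₀ β₁ t)) :
    ∃ S : Finset (coords P β₀ β₁ (middleSet P β₀ β₁ t)), i ∈ S ∧ S.card = P.n₂ ∧
      ∀ j ∈ S, ((j : evalSet P β₀ β₁) : F) ^ P.n₂ = ((i : evalSet P β₀ β₁) : F) ^ P.n₂ := by
  have hmem {y : F} : y ∈ middleSet P β₀ β₁ t ↔ y ^ P.n₁ = (β₀ ^ t) ^ P.n₁ :=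
    mem_coset (pow_ne_zero _ hβ₀) hβ₁ hn₁
  have hi := hmem.1 (HierCode.mem_coords.1 i.2)
  have hi0 : ((i : evalSet P β₀ β₁) : F) ≠ 0 := by
    intro h0
    rw [h0, zero_pow hn₁.ne'] at hi
    exact pow_ne_zero _ (pow_ne_zero _ hβ₀) hi.symm
  refine ⟨Finset.univ.filter fun j =>
    ((j : evalSet P β₀ β₁) : F) ^ P.n₂ = ((i : evalSet P β₀ β₁) : F) ^ P.n₂, by simp, ?_,
    fun j hj => (Finset.mem_filter.1 hj).2⟩
  refine Eq.trans ?_ (card_coset hi0 hβ₂)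
  rw [← Finset.card_image_of_injective _
    (Subtype.val_injective.comp (Subtype.val_injective (p := (· ∈ coords P β₀ β₁ _))))]
  congr 1
  ext y
  rw [mem_coset hi0 hβ₂ (Nat.pos_of_dvd_of_pos hn₂ hn₁)]
  simp only [Finset.mem_image, Finset.mem_filter, Finset.mem_univ, true_and, Function.comp_apply]
  constructor
  · rintro ⟨j, hj, rfl⟩
    exact hj
  · intro hy
    have hyt : y ∈ middleSet P β₀ β₁ t := by
      rw [hmem, ← hi]
      obtain ⟨μ, hμ⟩ := hn₂
      rw [hμ, pow_mul, pow_mul, hy]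
    exact ⟨⟨⟨y, middleSet_subset_evalSet ht hyt⟩, mem_coords.2 hyt⟩, hy, rfl⟩

end HierCode

theorem mainTheorem3 {F : Type*} [Field F] [Fintype F] [DecidableEq F]
    (P : CodeParams) (β₀ β₁ β₂ : F)
    (hn₂ : P.n₂ ∣ P.n₁) (hn₁ : P.n₁ ∣ P.n)
    (hF : P.n₁ ∣ Fintype.card F - 1) (hn : P.n < Fintype.card F)
    (hβ₀ : orderOf β₀ = Fintype.card F - 1) (hβ₁ : orderOf β₁ = P.n₁) (hβ₂ : orderOf β₂ = P.n₂)
    (hr₂ : 0 < P.r₂) (hr₂' : P.r₂ ≤ P.n₂)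
    (hr₁ : 0 < P.r₁) (hr₁' : P.r₁ ≤ P.n₁ / P.n₂ * P.r₂)
    (hk : 0 < P.k) (hk' : P.k ≤ P.n / P.n₁ * P.r₁)
    (hr₂r₁ : P.r₂ ∣ P.r₁) (hr₁k : P.r₁ ∣ P.k) :
    ∃ δ₁ δ₂ d : ℕ,
      IsLinearCode (HierCode.code P β₀ β₁) P.n P.k d ∧
      (∀ t < P.n / P.n₁, IsLinearCode
        (punctured (HierCode.code P β₀ β₁)
          (HierCode.coords P β₀ β₁ (HierCode.middleSet P β₀ β₁ t))) P.n₁ P.r₁ δ₁) ∧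
      (∀ t < P.n / P.n₁, ∀ s < P.n₁ / P.n₂,
        HierCode.localSet P β₀ β₁ β₂ t s ⊆ HierCode.middleSet P β₀ β₁ t ∧
        IsLinearCode
          (punctured (HierCode.code P β₀ β₁)
            (HierCode.coords P β₀ β₁ (HierCode.localSet P β₀ β₁ β₂ t s))) P.n₂ P.r₂ δ₂) ∧
      HasHierarchicalLocality (HierCode.code P β₀ β₁) P.r₁ δ₁ P.r₂ δ₂ ∧
      (d : ℤ) = P.n - P.k + 1 - (⌈(P.k : ℚ) / P.r₂⌉ - 1) * ((δ₂ : ℤ) - 1)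
        - (⌈(P.k : ℚ) / P.r₁⌉ - 1) * ((δ₁ : ℤ) - δ₂) ∧
      ∀ (K : Type*) [Field K] (C' : Submodule K (Fin P.n → K)) (d' : ℕ),
        IsLinearCode C' P.n P.k d' → HasHierarchicalLocality C' P.r₁ δ₁ P.r₂ δ₂ → d' ≤ d := by

  have hn₂pos : 0 < P.n₂ := hr₂.trans_le hr₂'
  have hμ₁ : 0 < P.n / P.n₁ := Nat.pos_of_ne_zero fun h => by simp [h] at hk'; omega
  have hμ₂ : 0 < P.n₁ / P.n₂ := Nat.pos_of_ne_zero fun h => by simp [h] at hr₁'; omega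
  have hn₁pos : 0 < P.n₁ := Nat.pos_of_ne_zero fun h => by simp [h] at hμ₂
  have hμn₁ : P.n / P.n₁ * P.n₁ = P.n := Nat.div_mul_cancel hn₁
  have hμn₂ : P.n₁ / P.n₂ * P.n₂ = P.n₁ := Nat.div_mul_cancel hn₂
  have hnpos : 0 < P.n := Nat.pos_of_ne_zero fun h => by simp [h] at hμ₁
  have hβ₀0 : β₀ ≠ 0 := by
    rintro rfl
    rw [orderOf_zero] at hβ₀
    omega
  have hγ₀ : Set.InjOn (fun a => (β₀ ^ a) ^ P.n₁) (Finset.range P.numMiddle) := by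
    have h := HierCode.injOn_node (F := F) (α := 1) (β := β₀) (μ := P.numMiddle) one_ne_zero hn₁pos
      (by rw [CodeParams.numMiddle, hμn₁, hβ₀]; omega)
    simpa only [one_mul] using h
  have hγ (t : ℕ) (_ : t < P.numMiddle) :
      Set.InjOn (fun b => (β₀ ^ t * β₁ ^ b) ^ P.n₂) (Finset.range P.numLocal) :=
    HierCode.injOn_node (pow_ne_zero _ hβ₀0) hn₂pos (by rw [CodeParams.numLocal, hμn₂, hβ₁])
  -- With `r₁ = (a + 1) r₂` and `k = (b + 1) r₁`, the slacks `q`, `p`, `w` are the excesses of the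
  -- lengths `n₂`, `n₁`, `n` over `r₂`, `(a + 1) n₂`, `(b + 1) n₁`.
  obtain ⟨a, ha⟩ : ∃ a, P.r₁ = (a + 1) * P.r₂ := by
    obtain ⟨a, ha⟩ := hr₂r₁
    obtain ⟨a, rfl⟩ := Nat.exists_eq_succ_of_ne_zero (n := a) (by rintro rfl; omega)
    exact ⟨a, ha.trans (mul_comm _ _)⟩
  obtain ⟨b, hb⟩ : ∃ b, P.k = (b + 1) * P.r₁ := by
    obtain ⟨b, hb⟩ := hr₁k
    obtain ⟨b, rfl⟩ := Nat.exists_eq_succ_of_ne_zero (n := b) (by rintro rfl; omega)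
    exact ⟨b, hb.trans (mul_comm _ _)⟩
  have haμ : a + 1 ≤ P.n₁ / P.n₂ := Nat.le_of_mul_le_mul_right (ha ▸ hr₁') hr₂
  have hbμ : b + 1 ≤ P.n / P.n₁ := Nat.le_of_mul_le_mul_right (hb ▸ hk') hr₁
  obtain ⟨q, hq⟩ := Nat.exists_eq_add_of_le hr₂'
  obtain ⟨p, hp⟩ := Nat.exists_eq_add_of_le
    ((Nat.mul_le_mul_right P.n₂ haμ).trans_eq hμn₂)
  obtain ⟨w, hw⟩ := Nat.exists_eq_add_of_le
    ((Nat.mul_le_mul_right P.n₁ hbμ).trans_eq hμn₁)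
  have hexp₂ := CodeParams.exp₂_eq_range hr₂'
  have hexp₁ : P.exp₁ = translates (Finset.range P.r₂) P.n₂ (a + 1) := by
    rw [CodeParams.exp₁_eq_translates hr₂' haμ ha, hexp₂]
  have hexp₁sub : P.exp₁ ⊆ Finset.range (a * P.n₂ + P.r₂) := by
    rw [hexp₁]
    exact translates_subset_range (Finset.Subset.refl _)
  have hexp₁sub' : P.exp₁ ⊆ Finset.range P.n₁ := by
    refine hexp₁sub.trans (Finset.range_subset_range.2 ?_)
    rw [hp, Nat.succ_mul]
    omega
  have hexp₁card : P.exp₁.card = P.r₁ := by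
    rw [hexp₁, card_translates (Finset.range_subset_range.2 hr₂'), Finset.card_range, ha]
  have hexp₀ : P.exp₀ = translates P.exp₁ P.n₁ (b + 1) := by
    rw [CodeParams.exp₀, hb, ← hexp₁card]
    exact trunc_translates hexp₁sub' hbμ
  have hexp₀sub : P.exp₀ ⊆ Finset.range (b * P.n₁ + (a * P.n₂ + P.r₂)) := by
    rw [hexp₀]
    exact translates_subset_range hexp₁sub
  have hcode := HierCode.code_eq_monomialCode hγ₀ hγ hr₂'
  -- On a middle set `X ^ n₁` is constant, so only the exponents `exp₁` matter there.
  have hmiddleCode (t : ℕ) (ht : t < P.n / P.n₁) :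
      HasLocality (punctured (HierCode.code P β₀ β₁)
        (HierCode.coords P β₀ β₁ (HierCode.middleSet P β₀ β₁ t))) P.r₂ (q + 1) ∧
      IsLinearCode (punctured (HierCode.code P β₀ β₁)
        (HierCode.coords P β₀ β₁ (HierCode.middleSet P β₀ β₁ t))) P.n₁ P.r₁ (p + q + 1) := by
    have hinj : Function.Injective fun i : HierCode.coords P β₀ β₁ (HierCode.middleSet P β₀ β₁ t) =>
        ((i : HierCode.evalSet P β₀ β₁) : F) := Subtype.val_injective.comp Subtype.val_injective
    have hcard := HierCode.card_coords (HierCode.middleSet_subset_evalSet (β₀ := β₀) (β₁ := β₁) ht)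
    rw [HierCode.middleSet, HierCode.card_coset (pow_ne_zero _ hβ₀0) hβ₁,
      ← HierCode.middleSet] at hcard
    have hloc := hasLocality_monomialCode hinj a.succ_pos
      (HierCode.exists_fibre hβ₀0 hn₁pos hn₂ hβ₁ hβ₂ ht) hr₂'
    rw [show P.n₂ + 1 - P.r₂ = q + 1 by omega] at hloc
    rw [hcode, punctured_monomialCode, hexp₀, monomialCode_translates (g := (β₀ ^ t) ^ P.n₁)
      (fun i => (HierCode.mem_coset (pow_ne_zero _ hβ₀0) hβ₁ hn₁pos).1
        (HierCode.mem_coords.1 i.2)) b.succ_pos, hexp₁]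
    refine ⟨hloc, ?_⟩
    rw [hp, hq] at hcard
    rw [hq] at hloc
    have h := isLinearCode_monomialCode_translates hinj hr₂ hcard hloc
    rwa [← hq, ← hp, ← ha] at h
  have hhier : HasHierarchicalLocality (HierCode.code P β₀ β₁) P.r₁ (p + q + 1) P.r₂ (q + 1) := by
    intro θ
    obtain ⟨t, ht, hθ⟩ := Finset.mem_biUnion.1 θ.2
    obtain ⟨hloc, -, hfin, hdist⟩ := hmiddleCode t (Finset.mem_range.1 ht)
    exact ⟨_, HierCode.mem_coords.2 hθ, hfin.le, fun v hv => hdist.2 hv, hloc⟩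
  -- The numbers `A₂` and `A₁` of the bound are `k / r₂ - 1 = b (a + 1) + a` and `k / r₁ - 1 = b`;
  -- it is met by `w + p + q + 1`, the difference of `n` and the largest exponent in `exp₀`.
  have hA₁ : b * P.r₁ < P.k := by
    rw [hb, Nat.succ_mul]
    omega
  have hA₂ : (b * (a + 1) + a) * P.r₂ < P.k := by
    have : P.k = (b * (a + 1) + a) * P.r₂ + P.r₂ := by
      rw [hb, ha]
      ring
    omega
  have hsum : w + p + q + 1 + (P.k - 1) + ((b * (a + 1) + a) * q + b * p) = P.n := by
    obtain ⟨k', hk'⟩ := Nat.exists_eq_succ_of_ne_zero hk.ne'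
    have h : P.n + 1 = w + p + q + 1 + P.k + ((b * (a + 1) + a) * q + b * p) := by
      rw [hw, hp, hq, hb, ha]
      ring
    omega
  have hsub₂ : q + 1 - 1 = q := Nat.add_sub_cancel _ _
  have hsub₁ : p + q + 1 - (q + 1) = p := by omega
  refine ⟨p + q + 1, q + 1, w + p + q + 1, ?_, fun t ht => (hmiddleCode t ht).2,
    fun t ht s _ => ?_, hhier, ?_, ?_⟩
  · have hcard : Fintype.card (HierCode.evalSet P β₀ β₁) = P.n := by
      rw [Fintype.card_coe, HierCode.card_evalSet hβ₀0 hn₁pos hβ₁ hγ₀, CodeParams.numMiddle, hμn₁]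
    have hB : b * P.n₁ + (a * P.n₂ + P.r₂) + (w + p + q) = P.n := by
      rw [hw, hp, hq]
      ring
    refine hhier.hasNestedRepair.isLinearCode (A₁ := b) (A₂ := b * (a + 1) + a) hcard ?_ ?_
      (by omega) (by omega) hA₁ hA₂ ?_
    · rw [hcode, finrank_monomialCode Subtype.val_injective, hexp₀, card_translates hexp₁sub',
        hexp₁card, hb]
      refine hexp₀sub.trans (Finset.range_subset_range.2 ?_)
      omega
    · have h := minDistGE_monomialCode (F := F) (x := fun θ : HierCode.evalSet P β₀ β₁ => (θ : F))
        Subtype.val_injective hexp₀sub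
      rw [hcode]
      rwa [hcard, show P.n + 1 - (b * P.n₁ + (a * P.n₂ + P.r₂)) = w + p + q + 1 by omega] at h
    · rw [hsub₁, hsub₂, hsum]
  · have hsub := HierCode.localSet_subset_middleSet hβ₀0 hn₁pos hn₂ hβ₁ hβ₂ t s
    refine ⟨hsub, ?_⟩
    have hβ₁0 : β₁ ≠ 0 := by
      rintro rfl
      rw [orderOf_zero] at hβ₁
      omega
    have hγ0 : β₀ ^ t * β₁ ^ s ≠ 0 := mul_ne_zero (pow_ne_zero _ hβ₀0) (pow_ne_zero _ hβ₁0)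
    have hcard := HierCode.card_coords (hsub.trans (HierCode.middleSet_subset_evalSet ht))
    rw [HierCode.localSet, HierCode.card_coset hγ0 hβ₂, ← HierCode.localSet] at hcard
    rw [hcode, punctured_monomialCode, hexp₀, monomialCode_translates (g := (β₀ ^ t) ^ P.n₁)
      (fun i => (HierCode.mem_coset (pow_ne_zero _ hβ₀0) hβ₁ hn₁pos).1
        (hsub (HierCode.mem_coords.1 i.2))) b.succ_pos, hexp₁,
      monomialCode_translates (g := (β₀ ^ t * β₁ ^ s) ^ P.n₂)
      (fun i => (HierCode.mem_coset hγ0 hβ₂ hn₂pos).1 (HierCode.mem_coords.1 i.2)) a.succ_pos]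
    rw [hq] at hcard
    have h := isLinearCode_monomialCode_range
      (x := fun i : HierCode.coords P β₀ β₁ (HierCode.localSet P β₀ β₁ β₂ t s) =>
        ((i : HierCode.evalSet P β₀ β₁) : F))
      (Subtype.val_injective.comp Subtype.val_injective) hr₂ hcard
    rwa [← hq] at h
  · have h₂ : (P.k : ℚ) / P.r₂ = ((b * (a + 1) + a + 1 : ℕ) : ℚ) := by
      rw [div_eq_iff (by exact_mod_cast hr₂.ne'), hb, ha]
      push_cast
      ring
    have h₁ : (P.k : ℚ) / P.r₁ = ((b + 1 : ℕ) : ℚ) := by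
      rw [div_eq_iff (by exact_mod_cast hr₁.ne'), hb]
      push_cast
      ring
    rw [h₂, h₁, Int.ceil_natCast, Int.ceil_natCast, hb, hw, hp, hq, ha]
    push_cast
    ring
  · intro K _ C' d' hC' hloc
    obtain ⟨hcard, hfin, hleast⟩ := hC'
    rw [← hfin] at hA₁ hA₂
    obtain ⟨v, hv, hvle⟩ := hloc.hasNestedRepair.exists_mem_codeWeights
      (by omega) (by omega) hA₁ hA₂
    have h := hleast.2 hv
    rw [hsub₁, hsub₂, hfin, hcard] at hvle
    omega
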